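/- A (finite) MDP consists of a finite state space of size $S$, a finite action space of size $A$, transition probabilities $p_{s,a}$ and reward distributions $r(s,a)$ on $[0,1]$ with means $\overline r_{s,a}$. The gain of a policy $\pi$ (a map from states to actions) is $g_\pi(s)=\lim_{T\to\infty}\frac1T\,\mathbb E_\pi\big[\sum_{t<T} r_t\mid s_0=s\big]$, and $\pi$ is optimal if it maximizes the gain in all states. An optimal bias vector is a vector $b$ such that, for some optimal policy $\pi$ of constant gain $g^\star$ and all states $s$, $$g^\star+b(s)=\overline r_{s,\pi(s)}+p_{s,\pi(s)}b=\max_a\{\overline r_{s,a}+p_{s,a}b\}.$$ If such a vector exists and is unique up to an additive constant, the optimal bias span $H=\max_s b(s)-\min_s b(s)$ is said to be well defined. An MDP is ergodic if under every policy every state is reached from every state in finite expected time. It is weakly communicating if there is a nonempty closed set $C$ of states such that any state of $C$ can be reached from any other in finite expected time under some policy, and all states outside $C$ are transient under every policy. An algorithm with a generative model knows the state and action spaces and may know the mean rewards. It may be randomized. At each step it chooses, from its past observations, a state-action pair $(s,a)$ and receives an independent sample of the reward and of the next state of $(s,a)$; it decides from its observations when to stop, and then outputs a real number $\hat H$. It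 computes a $\Delta$-tight upper bound for the optimal bias span with probability $1-\delta$ if, on every weakly communicating MDP with these states and actions whose optimal bias span $H$ is well defined, with probability at least $1-\delta$ it stops and $H\le\hat H\le H+\Delta$. **Theorem.** Let $\delta<\frac1{2e^4}$ and $\Delta$ be real numbers. 1. For every $T>0$ there is an ergodic MDP $\mathcal M$ with $S=3$, $A=2$ and optimal bias span $H=1/2$ such that every algorithm that computes a $\Delta$-tight upper bound for the optimal bias span with probability $1-\delta$, using a generative model, on MDPs with these states and actions, uses in expectation more than $T$ samples on $\mathcal M$. 2. Consequently no bound on this sample complexity depends only on $S,A,H,\delta,\Delta$: there is no real-valued function $f$ for which some such algorithm (for $S=3$, $A=2$) uses in expectation at most $f(S,A,H,\delta,\Delta)$ samples on every ergodic MDP whose optimal bias span $H$ is well defined. -/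

import Mathlib

open MeasureTheory Filter Topology
open scoped ENNReal

noncomputable section

/-- A Markov decision process with state space `S` and action space `A`: a transition kernel and
a reward kernel with values in the distributions on `[0,1]`. -/
structure MDP (S A : Type) where
  /-- transition probabilities -/
  P : S → A → PMF S
  /-- reward distributions -/
  r : S → A → ProbabilityMeasure unitInterval

namespace MDP

variable {S A : Type}

/-- Mean reward of a state-action pair. -/
def meanReward (M : MDP S A) (s : S) (a : A) : ℝ :=
  ∫ x, (x : ℝ) ∂(M.r s a : Measure unitInterval)

/-- Transition matrix of the stationary deterministic policy `π`. -/
def transition (M : MDP S A) (π : S → A) : Matrix S S ℝ :=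
  Matrix.of fun s s' => (M.P s (π s) s').toReal

/-- The expectation `p_{s,a} b` of `b` at the state that follows `(s, a)`. -/
def nextValue [Fintype S] (M : MDP S A) (b : S → ℝ) (s : S) (a : A) : ℝ :=
  ∑ s', (M.P s a s').toReal * b s'

/-- The expected reward `E[r_t | s_0 = s]` when policy `π` is followed. -/
def expectedReward [Fintype S] [DecidableEq S] (M : MDP S A) (π : S → A) (t : ℕ) (s : S) : ℝ :=
  ((M.transition π ^ t).mulVec fun u => M.meanReward u (π u)) s

/-- `g` is the gain of `π`: the limit of `T⁻¹ E[∑_{t<T} r_t | s_0 = s]` in every state `s`. -/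
def HasGain [Fintype S] [DecidableEq S] (M : MDP S A) (π : S → A) (g : S → ℝ) : Prop :=
  ∀ s, Tendsto (fun T : ℕ => (T : ℝ)⁻¹ * ∑ t ∈ Finset.range T, M.expectedReward π t s)
    atTop (𝓝 (g s))

/-- `π` maximizes the gain in all states. -/
def IsOptimalPolicy [Fintype S] [DecidableEq S] (M : MDP S A) (π : S → A) : Prop :=
  ∃ g, M.HasGain π g ∧ ∀ π' g', M.HasGain π' g' → ∀ s, g' s ≤ g s

/-- `b` is an optimal bias vector: for some optimal policy `π` of constant gain `gstar`, it solves
the Poisson equation of `π` and the average-reward optimality equation. -/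
def IsOptimalBias [Fintype S] [DecidableEq S] (M : MDP S A) (b : S → ℝ) : Prop :=
  ∃ (π : S → A) (gstar : ℝ), M.IsOptimalPolicy π ∧ M.HasGain π (fun _ => gstar) ∧
    (∀ s, gstar + b s = M.meanReward s (π s) + M.nextValue b s (π s)) ∧
    (∀ s, gstar + b s = ⨆ a, (M.meanReward s a + M.nextValue b s a))

/-- The optimal bias of `M` is well defined up to an additive constant, and its span
`max_s b s - min_s b s` is `H`. -/
def HasOptimalBiasSpan [Fintype S] [DecidableEq S] (M : MDP S A) (H : ℝ) : Prop :=
  (∃ b, M.IsOptimalBias b) ∧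
  (∀ b b', M.IsOptimalBias b → M.IsOptimalBias b' → ∃ c : ℝ, ∀ s, b' s = b s + c) ∧
  (∀ b, M.IsOptimalBias b → H = (⨆ s, b s) - ⨅ s, b s)

/-- `P(s_0 ≠ y, …, s_t ≠ y | s_0 = s)` when policy `π` is followed. -/
def avoidProb [Fintype S] [DecidableEq S] (M : MDP S A) (π : S → A) (y : S) : ℕ → S → ℝ
  | 0, s => if s = y then 0 else 1
  | t + 1, s => if s = y then 0 else ∑ u, (M.P s (π s) u).toReal * avoidProb M π y t u

/-- The expected hitting time `E[min {t ≥ 0 : s_t = y} | s_0 = s]` under `π`, as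
`∑_{t ≥ 0} P(hitting time > t)`. -/
def expectedHittingTime [Fintype S] [DecidableEq S] (M : MDP S A) (π : S → A) (s y : S) : ℝ≥0∞ :=
  ∑' t, ENNReal.ofReal (M.avoidProb π y t s)

/-- `s` is transient under `π`: the return time `min {t > 0 : s_t = s}` from `s_0 = s` is not
almost surely finite, i.e. the probability of no return within `t + 1` steps does not tend to `0`. -/
def IsTransient [Fintype S] [DecidableEq S] (M : MDP S A) (π : S → A) (s : S) : Prop :=
  ¬ Tendsto (fun t => ∑ u, (M.P s (π s) u).toReal * M.avoidProb π s t u) atTop (𝓝 0)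

/-- Under every policy, every state is reached from every state in finite expected time. -/
def IsErgodic [Fintype S] [DecidableEq S] (M : MDP S A) : Prop :=
  ∀ (π : S → A) (s y : S), M.expectedHittingTime π s y < ⊤

/-- There is a closed set of states which can all be reached from one another in finite expected
time, and all other states are transient under every policy. -/
def IsWeaklyCommunicating [Fintype S] [DecidableEq S] (M : MDP S A) : Prop :=
  ∃ C : Set S, C.Nonempty ∧
    (∀ s ∈ C, ∀ a, ∀ y ∉ C, M.P s a y = 0) ∧
    (∀ s ∈ C, ∀ y ∈ C, ∃ π : S → A, M.expectedHittingTime π s y < ⊤) ∧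
    (∀ s ∉ C, ∀ π : S → A, M.IsTransient π s)

/-- The law of one sample `(reward, next state)` that the generative model returns for the
state-action pair `q`. -/
def sampleLaw [MeasurableSpace S] (M : MDP S A) (q : S × A) : Measure (unitInterval × S) :=
  (M.r q.1 q.2 : Measure unitInterval).prod (M.P q.1 q.2).toMeasure

instance [MeasurableSpace S] (M : MDP S A) (q : S × A) : IsProbabilityMeasure (M.sampleLaw q) := by
  unfold sampleLaw; infer_instance

/-- The law of a table of independent samples. Entry `(t, q)` is what the generative model returns
if the state-action pair `q` is queried at time `t`; only one entry of each row `t` is ever read,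
so given the past, the answer to a query `q` has law `sampleLaw q`. -/
def tableLaw [MeasurableSpace S] (M : MDP S A) : Measure (ℕ × (S × A) → unitInterval × S) :=
  Measure.infinitePi fun i => M.sampleLaw i.2

end MDP

/-- The record of `t` calls to the generative model: the queries and the answers. -/
abbrev GenHistory (S A : Type) (t : ℕ) : Type := Fin t → (S × A) × (unitInterval × S)

/-- A (randomized, adaptive) estimation algorithm that uses a generative model. It may know the
mean rewards (first argument of its rules; an algorithm is free to ignore it), has an internal
source of randomness `Seed`, and consists of a sampling rule, a stopping rule and an output, which
depend on the seed and on the `t` samples seen so far. -/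
structure GenAlgorithm (S A : Type) [MeasurableSpace S] [MeasurableSpace A] where
  Seed : Type
  [measurableSeed : MeasurableSpace Seed]
  seedLaw : Measure Seed
  [isProb : IsProbabilityMeasure seedLaw]
  query : (S → A → ℝ) → (t : ℕ) → Seed × GenHistory S A t → S × A
  stopRule : (S → A → ℝ) → (t : ℕ) → Set (Seed × GenHistory S A t)
  output : (S → A → ℝ) → (t : ℕ) → Seed × GenHistory S A t → ℝ
  measurable_query : ∀ ρ t, Measurable (query ρ t)
  measurable_stopRule : ∀ ρ t, MeasurableSet (stopRule ρ t)
  measurable_output : ∀ ρ t, Measurable (output ρ t)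

namespace GenAlgorithm

attribute [instance] GenAlgorithm.measurableSeed GenAlgorithm.isProb

variable {S A : Type} [MeasurableSpace S] [MeasurableSpace A]

/-- The first `t` queries and answers, when the mean rewards are `ρ`, the seed is `u`, and the
generative model answers from the table `ω`. -/
def history (alg : GenAlgorithm S A) (ρ : S → A → ℝ) (u : alg.Seed)
    (ω : ℕ × (S × A) → unitInterval × S) : (t : ℕ) → GenHistory S A t
  | 0 => Fin.elim0
  | t + 1 =>
    Fin.snoc (α := fun _ => (S × A) × (unitInterval × S)) (history alg ρ u ω t)
      (alg.query ρ t (u, history alg ρ u ω t),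
        ω (t, alg.query ρ t (u, history alg ρ u ω t)))

/-- The stopping rule holds after `t` samples. -/
def StopsAt (alg : GenAlgorithm S A) (ρ : S → A → ℝ) (u : alg.Seed)
    (ω : ℕ × (S × A) → unitInterval × S) (t : ℕ) : Prop :=
  (u, alg.history ρ u ω t) ∈ alg.stopRule ρ t

/-- The total number of samples used before stopping, `⊤` if the algorithm never stops. -/
def numSamples (alg : GenAlgorithm S A) (ρ : S → A → ℝ) (u : alg.Seed)
    (ω : ℕ × (S × A) → unitInterval × S) : ℕ∞ :=
  ⨅ (t : ℕ) (_ : alg.StopsAt ρ u ω t), (t : ℕ∞)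

/-- The algorithm stops and outputs `x`. -/
def Outputs (alg : GenAlgorithm S A) (ρ : S → A → ℝ) (u : alg.Seed)
    (ω : ℕ × (S × A) → unitInterval × S) (x : ℝ) : Prop :=
  ∃ t : ℕ, alg.numSamples ρ u ω = t ∧ x = alg.output ρ t (u, alg.history ρ u ω t)

/-- Joint law of the seed and of the samples, on the MDP `M`. -/
def law (alg : GenAlgorithm S A) (M : MDP S A) :
    Measure (alg.Seed × (ℕ × (S × A) → unitInterval × S)) :=
  alg.seedLaw.prod M.tableLaw

/-- The expected number of samples used on `M`. -/
def expectedSamples (alg : GenAlgorithm S A) (M : MDP S A) : ℝ≥0∞ :=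
  ∫⁻ p, (alg.numSamples M.meanReward p.1 p.2 : ℝ≥0∞) ∂(alg.law M)

/-- On every weakly communicating MDP (over the given states and actions) with a well-defined
optimal bias span `H`, the algorithm outputs, with probability at least `1 - δ`, a value in
`[H, H + Δ]`. -/
def ComputesTightUpperBound [Fintype S] [DecidableEq S] (alg : GenAlgorithm S A) (Δ δ : ℝ) :
    Prop :=
  ∀ (M : MDP S A) (H : ℝ), M.IsWeaklyCommunicating → M.HasOptimalBiasSpan H →
    ENNReal.ofReal (1 - δ) ≤
      alg.law M {p | ∃ x, alg.Outputs M.meanReward p.1 p.2 x ∧ H ≤ x ∧ x ≤ H + Δ}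

end GenAlgorithm

end

/-!
The lower bound comes from the fact that the optimal bias of a slowly mixing MDP is discontinuous
in its transition probabilities, at the scale of what a bounded number of samples reveals.

Consider the three-state MDP `lazyMDP p x` which, from any state and under any action, jumps to
each of the two other states with probability `p` and stays put otherwise. The reward is `x` for
action `0` in state `0` and `0` for the other state-action pairs. Its optimal bias is, up to a
constant, `x / (3 p)` at state `0` and `0` elsewhere (`lazyMDP_hasOptimalBiasSpan`). With
`x = 3 p / 2` the span is `1 / 2`; dividing `p` by `L` while keeping `x`, hence all mean rewards,
multiplies the span by `L`, which can be pushed above `1 / 2 + Δ`.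

On the other hand all rewards are deterministic, and for small `p` a table of `n` rows of samples
shows no jump with probability at least `1 - 12 n p` in both MDPs (`tableLaw_not_agree_le`). So
an algorithm that mostly stops within `n` samples behaves on both as on the constant table
without jumps, and its output there cannot be correct for both spans. This is
`one_le_of_expectedSamples_le`, which holds for any two MDPs with the same mean rewards whose
samples mostly agree with one fixed table.
-/

/-! ### Running an algorithm on a fixed table of samples -/

namespace GenAlgorithm

variable {S A : Type} [MeasurableSpace S] [MeasurableSpace A]

theorem history_congr (alg : GenAlgorithm S A) (ρ : S → A → ℝ) (u : alg.Seed)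
    {ω ω' : ℕ × (S × A) → unitInterval × S} {n : ℕ} (h : ∀ t < n, ∀ q, ω (t, q) = ω' (t, q)) :
    ∀ t ≤ n, alg.history ρ u ω t = alg.history ρ u ω' t := by
  intro t
  induction t with
  | zero => intro _; rfl
  | succ t ih =>
    intro ht
    simp only [history, ih (by omega), h t (by omega)]

theorem stopsAt_congr (alg : GenAlgorithm S A) (ρ : S → A → ℝ) (u : alg.Seed)
    {ω ω' : ℕ × (S × A) → unitInterval × S} {n : ℕ} (h : ∀ t < n, ∀ q, ω (t, q) = ω' (t, q))
    {t : ℕ} (ht : t ≤ n) : alg.StopsAt ρ u ω t ↔ alg.StopsAt ρ u ω' t := by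
  simp only [StopsAt, alg.history_congr ρ u h t ht]

theorem natCast_lt_numSamples_iff (alg : GenAlgorithm S A) (ρ : S → A → ℝ) (u : alg.Seed)
    (ω : ℕ × (S × A) → unitInterval × S) (n : ℕ) :
    (n : ℕ∞) < alg.numSamples ρ u ω ↔ ∀ t ≤ n, ¬ alg.StopsAt ρ u ω t := by
  constructor
  · intro h t ht hs
    have h1 : alg.numSamples ρ u ω ≤ (t : ℕ∞) := iInf₂_le t hs
    have h2 : (t : ℕ∞) ≤ n := by exact_mod_cast ht
    exact absurd h (not_lt.mpr (h1.trans h2))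
  · intro h
    have h1 : ((n + 1 : ℕ) : ℕ∞) ≤ alg.numSamples ρ u ω := by
      refine le_iInf₂ fun t ht => ?_
      have : n + 1 ≤ t := by
        by_contra hlt
        exact h t (by omega) ht
      exact_mod_cast this
    exact lt_of_lt_of_le (by exact_mod_cast Nat.lt_succ_self n) h1

theorem numSamples_eq_natCast_iff (alg : GenAlgorithm S A) (ρ : S → A → ℝ) (u : alg.Seed)
    (ω : ℕ × (S × A) → unitInterval × S) (t : ℕ) :
    alg.numSamples ρ u ω = t ↔ alg.StopsAt ρ u ω t ∧ ∀ s < t, ¬ alg.StopsAt ρ u ω s := by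
  constructor
  · intro h
    have h1 : ∀ s < t, ¬ alg.StopsAt ρ u ω s := by
      intro s hs hst
      have h2 : alg.numSamples ρ u ω ≤ (s : ℕ∞) := iInf₂_le s hst
      rw [h] at h2
      have h3 : t ≤ s := by exact_mod_cast h2
      omega
    refine ⟨?_, h1⟩
    by_contra h2
    have h3 := (alg.natCast_lt_numSamples_iff ρ u ω t).mpr fun s hs => by
      rcases hs.eq_or_lt with rfl | hs
      · exact h2
      · exact h1 s hs
    rw [h] at h3
    exact lt_irrefl _ h3
  · rintro ⟨h1, h2⟩
    refine le_antisymm (iInf₂_le t h1) (le_iInf₂ fun s hs => ?_)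
    have : t ≤ s := not_lt.mp fun hlt => h2 s hlt hs
    exact_mod_cast this

theorem measurable_history [Finite S] [Finite A] [MeasurableSingletonClass S]
    [MeasurableSingletonClass A] (alg : GenAlgorithm S A) (ρ : S → A → ℝ)
    (ω : ℕ × (S × A) → unitInterval × S) (t : ℕ) :
    Measurable fun u => alg.history ρ u ω t := by
  induction t with
  | zero => exact measurable_const
  | succ t ih =>
    have hq : Measurable fun u => alg.query ρ t (u, alg.history ρ u ω t) :=
      (alg.measurable_query ρ t).comp (measurable_id.prodMk ih)
    have hω : Measurable fun q => ω (t, q) := measurable_of_finite _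
    refine measurable_pi_iff.mpr fun i => ?_
    refine Fin.lastCases ?_ (fun j => ?_) i
    · simp only [history, Fin.snoc_last]
      exact hq.prodMk (hω.comp hq)
    · simp only [history, Fin.snoc_castSucc]
      exact (measurable_pi_iff.mp ih) j

theorem measurableSet_stopsAt [Finite S] [Finite A] [MeasurableSingletonClass S]
    [MeasurableSingletonClass A] (alg : GenAlgorithm S A) (ρ : S → A → ℝ)
    (ω : ℕ × (S × A) → unitInterval × S) (t : ℕ) :
    MeasurableSet {u | alg.StopsAt ρ u ω t} :=
  (measurable_id.prodMk (alg.measurable_history ρ ω t)) (alg.measurable_stopRule ρ t)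

/-- The seeds for which the algorithm, run on the table `ω`, stops after at most `n` samples with
an output in `I`. -/
def stopsWithin (alg : GenAlgorithm S A) (ρ : S → A → ℝ)
    (ω : ℕ × (S × A) → unitInterval × S) (n : ℕ) (I : Set ℝ) : Set alg.Seed :=
  {u | ∃ t ≤ n, alg.numSamples ρ u ω = t ∧ alg.output ρ t (u, alg.history ρ u ω t) ∈ I}

theorem measurableSet_stopsWithin [Finite S] [Finite A] [MeasurableSingletonClass S]
    [MeasurableSingletonClass A] (alg : GenAlgorithm S A) (ρ : S → A → ℝ)
    (ω : ℕ × (S × A) → unitInterval × S) (n : ℕ) {I : Set ℝ} (hI : MeasurableSet I) :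
    MeasurableSet (alg.stopsWithin ρ ω n I) := by
  have h : alg.stopsWithin ρ ω n I = ⋃ t, ⋃ (_ : t ≤ n),
      (({u | alg.StopsAt ρ u ω t} ∩ ⋂ s, ⋂ (_ : s < t), {u | alg.StopsAt ρ u ω s}ᶜ) ∩
        {u | alg.output ρ t (u, alg.history ρ u ω t) ∈ I}) := by
    ext u
    simp [stopsWithin, numSamples_eq_natCast_iff, and_left_comm]
  rw [h]
  refine MeasurableSet.iUnion fun t => MeasurableSet.iUnion fun _ => ?_
  refine ((alg.measurableSet_stopsAt ρ ω t).inter ?_).inter ?_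
  · exact MeasurableSet.iInter fun s => MeasurableSet.iInter fun _ =>
      (alg.measurableSet_stopsAt ρ ω s).compl
  · exact ((alg.measurable_output ρ t).comp
      (measurable_id.prodMk (alg.measurable_history ρ ω t))) hI

theorem measurableSet_lt_numSamples [Finite S] [Finite A] [MeasurableSingletonClass S]
    [MeasurableSingletonClass A] (alg : GenAlgorithm S A) (ρ : S → A → ℝ)
    (ω : ℕ × (S × A) → unitInterval × S) (n : ℕ) :
    MeasurableSet {u | (n : ℕ∞) < alg.numSamples ρ u ω} := by
  have h : {u | (n : ℕ∞) < alg.numSamples ρ u ω} =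
      ⋂ t, ⋂ (_ : t ≤ n), {u | alg.StopsAt ρ u ω t}ᶜ := by
    ext u
    simp [natCast_lt_numSamples_iff]
  rw [h]
  exact MeasurableSet.iInter fun t => MeasurableSet.iInter fun _ =>
    (alg.measurableSet_stopsAt ρ ω t).compl

end GenAlgorithm

/-! ### Indistinguishable MDPs -/

/-- The tables whose first `n` rows are all equal to `a`. -/
def agreeBelow {S A : Type} (a : S × A → unitInterval × S) (n : ℕ) :
    Set (ℕ × (S × A) → unitInterval × S) :=
  {ω | ∀ t < n, ∀ q, ω (t, q) = a q}

section

variable {S A : Type} [MeasurableSpace S]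

theorem measurableSet_agreeBelow [MeasurableSingletonClass S] [Countable S] [Countable A]
    (a : S × A → unitInterval × S) (n : ℕ) : MeasurableSet (agreeBelow a n) := by
  have h : agreeBelow a n = ⋂ t, ⋂ (_ : t < n), ⋂ q,
      (fun ω : ℕ × (S × A) → unitInterval × S => ω (t, q)) ⁻¹' {a q} := by
    ext ω
    simp [agreeBelow]
  rw [h]
  exact MeasurableSet.iInter fun t => MeasurableSet.iInter fun _ => MeasurableSet.iInter fun q =>
    (measurable_pi_apply (t, q)) (measurableSet_singleton _)

theorem MDP.tableLaw_not_agree_le [MeasurableSingletonClass S] [Fintype S] [Fintype A]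
    (M : MDP S A) (a : S × A → unitInterval × S) (n : ℕ) {ε : ℝ≥0∞}
    (h : ∀ q, M.sampleLaw q {a q}ᶜ ≤ ε) :
    M.tableLaw (agreeBelow a n)ᶜ ≤ n * (Fintype.card (S × A) * ε) := by
  have hsub : (agreeBelow a n)ᶜ ⊆ ⋃ t ∈ Finset.range n, ⋃ q ∈ (Finset.univ : Finset (S × A)),
      (fun ω : ℕ × (S × A) → unitInterval × S => ω (t, q)) ⁻¹' {a q}ᶜ := by
    intro ω hω
    simpa [agreeBelow] using hω
  refine (measure_mono hsub).trans ((measure_biUnion_finset_le _ _).trans ?_)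
  have hrow : ∀ t ∈ Finset.range n, M.tableLaw (⋃ q ∈ (Finset.univ : Finset (S × A)),
      (fun ω : ℕ × (S × A) → unitInterval × S => ω (t, q)) ⁻¹' {a q}ᶜ)
      ≤ Fintype.card (S × A) * ε := by
    intro t _
    refine (measure_biUnion_finset_le _ _).trans ?_
    refine (Finset.sum_le_sum (g := fun _ => ε) fun q _ => ?_).trans (by simp)
    have hmp := measurePreserving_eval_infinitePi
      (fun i : ℕ × (S × A) => M.sampleLaw i.2) (t, q)
    have := hmp.measure_preimage (measurableSet_singleton (a q)).compl.nullMeasurableSet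
    exact this.le.trans (h q)
  exact (Finset.sum_le_sum hrow).trans (by simp)

theorem GenAlgorithm.law_real_fst_preimage [MeasurableSpace A] (alg : GenAlgorithm S A)
    (M : MDP S A) (B : Set alg.Seed) :
    (alg.law M).real (Prod.fst ⁻¹' B) = alg.seedLaw.real B := by
  have : IsProbabilityMeasure M.tableLaw := by unfold MDP.tableLaw; infer_instance
  have h : (Prod.fst ⁻¹' B : Set (alg.Seed × (ℕ × (S × A) → unitInterval × S))) =
      B ×ˢ Set.univ := by ext; simp
  rw [Measure.real, Measure.real, h, GenAlgorithm.law, Measure.prod_prod, measure_univ, mul_one]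

theorem GenAlgorithm.law_real_snd_preimage [MeasurableSpace A] (alg : GenAlgorithm S A)
    (M : MDP S A) (D : Set (ℕ × (S × A) → unitInterval × S)) :
    (alg.law M).real (Prod.snd ⁻¹' D) = M.tableLaw.real D := by
  have : IsProbabilityMeasure M.tableLaw := by unfold MDP.tableLaw; infer_instance
  have h : (Prod.snd ⁻¹' D : Set (alg.Seed × (ℕ × (S × A) → unitInterval × S))) =
      Set.univ ×ˢ D := by ext; simp
  rw [Measure.real, Measure.real, h, GenAlgorithm.law, Measure.prod_prod, measure_univ, one_mul]

/-- Two MDPs with the same mean rewards, whose optimal bias spans are more than `Δ` apart and whose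
tables agree in the first `n` rows with one and the same constant table up to probability `η`,
can only be told apart at the price of many samples: the failure probability `δ`, the
probability `η` and the Markov bound `T / n` for using more than `n` samples cannot all be small.

In the proof, `B` is the set of seeds for which the algorithm, run on the constant table, stops
within `n` samples with an answer that is right for `M`. Correctness on `M` makes `B` likely,
correctness on `M'` makes it unlikely. -/
theorem GenAlgorithm.one_le_of_expectedSamples_le [MeasurableSingletonClass S] [Fintype S]
    [DecidableEq S] [Fintype A] [MeasurableSpace A] [MeasurableSingletonClass A]
    (alg : GenAlgorithm S A) {Δ δ : ℝ}
    (halg : alg.ComputesTightUpperBound Δ δ) {M M' : MDP S A} {H H' : ℝ}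
    (hM : M.IsWeaklyCommunicating) (hM' : M'.IsWeaklyCommunicating)
    (hH : M.HasOptimalBiasSpan H) (hH' : M'.HasOptimalBiasSpan H')
    (hmean : M'.meanReward = M.meanReward) (hlt : H + Δ < H')
    (a : S × A → unitInterval × S) {n : ℕ} (hn : 0 < n) {η T : ℝ}
    (hη : M.tableLaw.real (agreeBelow a n)ᶜ ≤ η)
    (hη' : M'.tableLaw.real (agreeBelow a n)ᶜ ≤ η) (hT : 0 ≤ T)
    (hsamples : alg.expectedSamples M ≤ ENNReal.ofReal T) :
    1 ≤ 2 * δ + 2 * η + T / n := by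
  have : IsProbabilityMeasure M.tableLaw := by unfold MDP.tableLaw; infer_instance
  have : IsProbabilityMeasure M'.tableLaw := by unfold MDP.tableLaw; infer_instance
  have : IsProbabilityMeasure (alg.law M) := by unfold GenAlgorithm.law; infer_instance
  have : IsProbabilityMeasure (alg.law M') := by unfold GenAlgorithm.law; infer_instance
  set ρ := M.meanReward with hρ
  let ω₀ : ℕ × (S × A) → unitInterval × S := fun i => a i.2
  set B := alg.stopsWithin ρ ω₀ n (Set.Icc H (H + Δ)) with hB
  have hBm : MeasurableSet B := alg.measurableSet_stopsWithin ρ ω₀ n measurableSet_Icc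
  set F : Set alg.Seed := {u | (n : ℕ∞) < alg.numSamples ρ u ω₀} with hF
  set D : Set (alg.Seed × (ℕ × (S × A) → unitInterval × S)) :=
    Prod.snd ⁻¹' agreeBelow a n with hD
  have hDm : MeasurableSet D := measurable_snd (measurableSet_agreeBelow a n)
  have hFm : MeasurableSet F := alg.measurableSet_lt_numSamples ρ ω₀ n
  have hagree : ∀ p ∈ D, ∀ t < n, ∀ q, p.2 (t, q) = ω₀ (t, q) := fun p hp => hp
  have heq : ∀ p ∈ D, ∀ t ≤ n,
      (alg.numSamples ρ p.1 p.2 = t ↔ alg.numSamples ρ p.1 ω₀ = t) := by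
    intro p hp t ht
    simp only [numSamples_eq_natCast_iff, alg.stopsAt_congr ρ p.1 (hagree p hp) ht]
    refine and_congr_right fun _ => forall₂_congr fun s hs => ?_
    rw [alg.stopsAt_congr ρ p.1 (hagree p hp) (hs.le.trans ht)]
  -- Markov's inequality for the event that no stop occurs within `n` samples.
  have hmarkov : (alg.law M).real (D ∩ Prod.fst ⁻¹' F) ≤ T / n := by
    have h1 : (n : ℝ≥0∞) * alg.law M (D ∩ Prod.fst ⁻¹' F) ≤ ENNReal.ofReal T := by
      refine le_trans ?_ hsamples
      rw [← lintegral_indicator_const (hDm.inter (measurable_fst hFm))]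
      refine lintegral_mono fun p => ?_
      by_cases hp : p ∈ D ∩ Prod.fst ⁻¹' F
      · rw [Set.indicator_of_mem hp]
        have h2 : (n : ℕ∞) < alg.numSamples ρ p.1 p.2 := by
          have h3 := hp.2
          simp only [hF, Set.mem_preimage, Set.mem_ofPred_eq, natCast_lt_numSamples_iff] at h3 ⊢
          intro t ht
          rw [alg.stopsAt_congr ρ p.1 (hagree p hp.1) ht]
          exact h3 t ht
        have := ENat.toENNReal_le.mpr h2.le
        simpa using this
      · rw [Set.indicator_of_notMem hp]
        exact bot_le
    have h2 := ENNReal.toReal_mono ENNReal.ofReal_ne_top h1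
    rw [ENNReal.toReal_mul, ENNReal.toReal_natCast, ENNReal.toReal_ofReal hT] at h2
    rw [le_div_iff₀ (by exact_mod_cast hn), mul_comm]
    exact h2
  have hDc : ∀ N : MDP S A, (alg.law N).real Dᶜ = N.tableLaw.real (agreeBelow a n)ᶜ :=
    fun N => alg.law_real_snd_preimage N (agreeBelow a n)ᶜ
  have hlow : 1 - δ ≤ η + T / n + alg.seedLaw.real B := by
    set E : Set (alg.Seed × (ℕ × (S × A) → unitInterval × S)) :=
      {p | ∃ x, alg.Outputs ρ p.1 p.2 x ∧ H ≤ x ∧ x ≤ H + Δ} with hE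
    have h1 : 1 - δ ≤ (alg.law M).real E :=
      (ENNReal.ofReal_le_iff_le_toReal (measure_ne_top _ _)).mp (halg M H hM hH)
    have h2 : E ⊆ (Dᶜ ∪ D ∩ Prod.fst ⁻¹' F) ∪ Prod.fst ⁻¹' B := by
      rintro p ⟨x, ⟨t, ht, rfl⟩, hx⟩
      by_cases hp : p ∈ D
      · by_cases htn : t ≤ n
        · right
          refine ⟨t, htn, (heq p hp t htn).mp ht, ?_⟩
          rw [← alg.history_congr ρ p.1 (hagree p hp) t htn]
          exact hx
        · left; right
          refine ⟨hp, ?_⟩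
          have h3 : (n : ℕ∞) < alg.numSamples ρ p.1 p.2 := by
            rw [ht]; exact_mod_cast not_le.mp htn
          simp only [hF, Set.mem_preimage, Set.mem_ofPred_eq, natCast_lt_numSamples_iff] at h3 ⊢
          intro s hs
          rw [← alg.stopsAt_congr ρ p.1 (hagree p hp) hs]
          exact h3 s hs
      · left; left; exact hp
    have h3 := measureReal_mono (μ := alg.law M) h2
    have h4 := measureReal_union_le (μ := alg.law M) (Dᶜ ∪ D ∩ Prod.fst ⁻¹' F) (Prod.fst ⁻¹' B)
    have h5 := measureReal_union_le (μ := alg.law M) Dᶜ (D ∩ Prod.fst ⁻¹' F)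
    rw [alg.law_real_fst_preimage M B] at h4
    rw [hDc M] at h5
    linarith
  have hupp : 1 - δ ≤ η + (1 - alg.seedLaw.real B) := by
    set E : Set (alg.Seed × (ℕ × (S × A) → unitInterval × S)) :=
      {p | ∃ x, alg.Outputs ρ p.1 p.2 x ∧ H' ≤ x ∧ x ≤ H' + Δ} with hE
    have h1 : 1 - δ ≤ (alg.law M').real E := by
      have h := halg M' H' hM' hH'
      rw [hmean] at h
      exact (ENNReal.ofReal_le_iff_le_toReal (measure_ne_top _ _)).mp h
    have h2 : E ⊆ Dᶜ ∪ Prod.fst ⁻¹' Bᶜ := by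
      rintro p ⟨x, ⟨t, ht, rfl⟩, hx, -⟩
      by_cases hp : p ∈ D
      · right
        rintro ⟨t', ht', hs, ho⟩
        rw [← heq p hp t' ht'] at hs
        have htt : t' = t := by
          have := hs.symm.trans ht
          exact_mod_cast this
        subst htt
        rw [← alg.history_congr ρ p.1 (hagree p hp) t' ht'] at ho
        linarith [ho.2]
      · left; exact hp
    have h3 := measureReal_mono (μ := alg.law M') h2
    have h4 := measureReal_union_le (μ := alg.law M') Dᶜ (Prod.fst ⁻¹' Bᶜ)
    rw [alg.law_real_fst_preimage M' Bᶜ, hDc M', probReal_compl_eq_one_sub hBm] at h4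
    linarith
  linarith

end

theorem MDP.IsErgodic.isWeaklyCommunicating {S A : Type} [Fintype S] [DecidableEq S] [Nonempty S]
    [Nonempty A] {M : MDP S A} (h : M.IsErgodic) : M.IsWeaklyCommunicating :=
  ⟨Set.univ, Set.univ_nonempty, fun _ _ _ _ hy => absurd (Set.mem_univ _) hy,
    fun s _ y _ => ⟨fun _ => Classical.arbitrary A, h _ s y⟩,
    fun _ hs => absurd (Set.mem_univ _) hs⟩

/-! ### The lazy three-state MDP -/

/-- The next-state distribution from `s`: each of the two other states has probability `p`. -/
noncomputable def lazyStep (p : ℝ) (hp : 0 < p) (hp3 : p ≤ 1 / 3) (s : Fin 3) : PMF (Fin 3) :=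
  PMF.ofFintype (fun u => ENNReal.ofReal (if u = s then 1 - 2 * p else p)) (by
    rw [← ENNReal.ofReal_sum_of_nonneg (fun u _ => by split_ifs <;> linarith),
      ENNReal.ofReal_eq_one]
    fin_cases s <;> simp [Fin.sum_univ_three] <;> ring)

/-- The reward of a state-action pair: `x` for action `0` in state `0`, and `0` otherwise. -/
def lazyReward (x : unitInterval) (s : Fin 3) (a : Fin 2) : unitInterval :=
  if s = 0 ∧ a = 0 then x else 0

/-- The MDP that jumps, under both actions, from any state to each of the two others with
probability `p`, and has the deterministic rewards `lazyReward x`. -/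
noncomputable def lazyMDP (p : ℝ) (hp : 0 < p) (hp3 : p ≤ 1 / 3) (x : unitInterval) :
    MDP (Fin 3) (Fin 2) where
  P s _ := lazyStep p hp hp3 s
  r s a := ⟨Measure.dirac (lazyReward x s a), inferInstance⟩

section

variable (p : ℝ) (hp : 0 < p) (hp3 : p ≤ 1 / 3) (x : unitInterval)

theorem lazyMDP_meanReward (s : Fin 3) (a : Fin 2) :
    (lazyMDP p hp hp3 x).meanReward s a = lazyReward x s a := by
  simp [MDP.meanReward, lazyMDP]

theorem lazyMDP_P_toReal (s u : Fin 3) (a : Fin 2) :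
    ((lazyMDP p hp hp3 x).P s a u).toReal = if u = s then 1 - 2 * p else p := by
  simp only [lazyMDP, lazyStep, PMF.ofFintype_apply]
  exact ENNReal.toReal_ofReal (by split_ifs <;> linarith)

/-- The transition matrix is `(1 - 3 p) • 1` plus the matrix with all entries `p`. -/
theorem sum_lazyMDP_P_mul (s : Fin 3) (a : Fin 2) (v : Fin 3 → ℝ) :
    ∑ u, ((lazyMDP p hp hp3 x).P s a u).toReal * v u = (1 - 3 * p) * v s + p * ∑ u, v u := by
  simp only [lazyMDP_P_toReal, Fin.sum_univ_three]
  fin_cases s <;> simp <;> ring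

theorem lazyMDP_expectedReward (π : Fin 3 → Fin 2) (t : ℕ) (s : Fin 3) :
    (lazyMDP p hp hp3 x).expectedReward π t s =
      (∑ u, (lazyReward x u (π u) : ℝ)) / 3 + (1 - 3 * p) ^ t *
        ((lazyReward x s (π s) : ℝ) - (∑ u, (lazyReward x u (π u) : ℝ)) / 3) := by
  induction t generalizing s with
  | zero => simp [MDP.expectedReward, lazyMDP_meanReward]
  | succ t ih =>
    have h : (lazyMDP p hp hp3 x).expectedReward π (t + 1) s =
        ∑ u, ((lazyMDP p hp hp3 x).P s (π s) u).toReal *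
          (lazyMDP p hp hp3 x).expectedReward π t u := by
      simp only [MDP.expectedReward]
      rw [pow_succ', ← Matrix.mulVec_mulVec]
      rfl
    rw [h, sum_lazyMDP_P_mul]
    simp only [ih, Fin.sum_univ_three]
    ring

theorem lazyMDP_hasGain (π : Fin 3 → Fin 2) :
    (lazyMDP p hp hp3 x).HasGain π fun _ => (∑ u, (lazyReward x u (π u) : ℝ)) / 3 := by
  intro s
  refine Tendsto.cesaro ?_
  simp only [lazyMDP_expectedReward]
  have h : Tendsto (fun t : ℕ => (1 - 3 * p) ^ t) atTop (𝓝 0) :=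
    tendsto_pow_atTop_nhds_zero_of_lt_one (by linarith) (by linarith)
  simpa using (h.mul_const _).const_add ((∑ u, (lazyReward x u (π u) : ℝ)) / 3)

theorem lazyReward_le (s : Fin 3) (a : Fin 2) :
    (lazyReward x s a : ℝ) ≤ lazyReward x s 0 := by
  have := x.2.1
  unfold lazyReward
  split_ifs <;> simp_all

theorem lazyMDP_isOptimalPolicy : (lazyMDP p hp hp3 x).IsOptimalPolicy fun _ => 0 := by
  refine ⟨_, lazyMDP_hasGain p hp hp3 x _, fun π' g' hg' s => ?_⟩
  rw [tendsto_nhds_unique (hg' s) (lazyMDP_hasGain p hp hp3 x π' s)]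
  simp only
  gcongr with u
  exact lazyReward_le x u (π' u)

/-- Action `0` attains the maximum in the optimality equation, whatever the vector `b`. -/
theorem lazyMDP_iSup_eq (b : Fin 3 → ℝ) (s : Fin 3) :
    (⨆ a, ((lazyMDP p hp hp3 x).meanReward s a + (lazyMDP p hp hp3 x).nextValue b s a)) =
      lazyReward x s 0 + ((1 - 3 * p) * b s + p * ∑ u, b u) := by
  simp only [MDP.nextValue, sum_lazyMDP_P_mul, lazyMDP_meanReward]
  refine le_antisymm (ciSup_le fun a => ?_) ?_
  · gcongr
    exact lazyReward_le x s a
  · exact le_ciSup (f := fun a => (lazyReward x s a : ℝ) + ((1 - 3 * p) * b s + p * ∑ u, b u))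
      (Set.finite_range _).bddAbove 0

theorem lazyMDP_isOptimalBias :
    (lazyMDP p hp hp3 x).IsOptimalBias fun s => (lazyReward x s 0 : ℝ) / (3 * p) := by
  have key : ∀ s, (∑ u, (lazyReward x u 0 : ℝ)) / 3 + (lazyReward x s 0 : ℝ) / (3 * p) =
      lazyReward x s 0 + ((1 - 3 * p) * ((lazyReward x s 0 : ℝ) / (3 * p)) +
        p * ∑ u, (lazyReward x u 0 : ℝ) / (3 * p)) := by
    intro s
    rw [← Finset.sum_div]
    field_simp
    ring
  refine ⟨fun _ => 0, _, lazyMDP_isOptimalPolicy p hp hp3 x, lazyMDP_hasGain p hp hp3 x _, ?_, ?_⟩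
  · intro s
    simp only [MDP.nextValue, sum_lazyMDP_P_mul, lazyMDP_meanReward]
    exact key s
  · intro s
    rw [lazyMDP_iSup_eq]
    exact key s

/-- Subtracting the optimality equations at `s` and at state `1` leaves
`3 p (b s - b 1) = lazyReward x s 0`. -/
theorem lazyMDP_isOptimalBias_apply {b : Fin 3 → ℝ} (hb : (lazyMDP p hp hp3 x).IsOptimalBias b)
    (s : Fin 3) : b s = b 1 + (lazyReward x s 0 : ℝ) / (3 * p) := by
  obtain ⟨π, g, -, -, -, h⟩ := hb
  simp only [lazyMDP_iSup_eq] at h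
  have hs := h s
  have h1 := h 1
  have h0 : (lazyReward x 1 0 : ℝ) = 0 := by simp [lazyReward]
  rw [h0] at h1
  have : (lazyReward x s 0 : ℝ) = (b s - b 1) * (3 * p) := by linarith
  rw [this]
  field_simp
  ring

theorem lazyMDP_hasOptimalBiasSpan :
    (lazyMDP p hp hp3 x).HasOptimalBiasSpan ((x : ℝ) / (3 * p)) := by
  refine ⟨⟨_, lazyMDP_isOptimalBias p hp hp3 x⟩, fun b b' hb hb' => ⟨b' 1 - b 1, fun s => ?_⟩,
    fun b hb => ?_⟩
  · rw [lazyMDP_isOptimalBias_apply p hp hp3 x hb s, lazyMDP_isOptimalBias_apply p hp hp3 x hb' s]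
    ring
  · have hx : 0 ≤ (x : ℝ) / (3 * p) := div_nonneg x.2.1 (by linarith)
    have h0 : b 0 = b 1 + (x : ℝ) / (3 * p) := by
      simpa [lazyReward] using lazyMDP_isOptimalBias_apply p hp hp3 x hb 0
    have h2 : b 2 = b 1 := by
      simpa [lazyReward] using lazyMDP_isOptimalBias_apply p hp hp3 x hb 2
    have hsup : (⨆ s, b s) = b 0 := by
      refine le_antisymm (ciSup_le fun s => ?_) (le_ciSup (Set.finite_range b).bddAbove 0)
      fin_cases s <;> simp <;> linarith
    have hinf : (⨅ s, b s) = b 1 := by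
      refine le_antisymm (ciInf_le (Set.finite_range b).bddBelow 1) (le_ciInf fun s => ?_)
      fin_cases s <;> simp <;> linarith
    rw [hsup, hinf, h0]
    ring

theorem lazyMDP_avoidProb (π : Fin 3 → Fin 2) (y : Fin 3) (t : ℕ) (s : Fin 3) :
    (lazyMDP p hp hp3 x).avoidProb π y t s = if s = y then 0 else (1 - p) ^ t := by
  induction t generalizing s with
  | zero => simp [MDP.avoidProb]
  | succ t ih =>
    simp only [MDP.avoidProb, ih, lazyMDP_P_toReal, Fin.sum_univ_three]
    fin_cases s <;> fin_cases y <;> simp <;> ring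

theorem lazyMDP_isErgodic : (lazyMDP p hp hp3 x).IsErgodic := by
  intro π s y
  have hsum : Summable fun t : ℕ => (lazyMDP p hp hp3 x).avoidProb π y t s := by
    simp only [lazyMDP_avoidProb]
    split_ifs
    · exact summable_zero
    · exact summable_geometric_of_lt_one (by linarith) (by linarith)
  exact lt_top_iff_ne_top.mpr hsum.tsum_ofReal_ne_top

/-- The sample of `q` when no jump occurs: the deterministic reward and an unchanged state. -/
def lazySample (q : Fin 3 × Fin 2) : unitInterval × Fin 3 :=
  (lazyReward x q.1 q.2, q.1)

theorem lazyMDP_sampleLaw_compl (q : Fin 3 × Fin 2) :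
    (lazyMDP p hp hp3 x).sampleLaw q {lazySample x q}ᶜ ≤ ENNReal.ofReal (2 * p) := by
  have h : (lazyMDP p hp hp3 x).sampleLaw q {lazySample x q} = ENNReal.ofReal (1 - 2 * p) := by
    rw [lazySample, ← Set.singleton_prod_singleton, MDP.sampleLaw, Measure.prod_prod,
      PMF.toMeasure_apply_singleton _ _ (measurableSet_singleton _)]
    simp [lazyMDP, lazyStep]
  rw [prob_compl_eq_one_sub (measurableSet_singleton _), h, ← ENNReal.ofReal_one,
    ← ENNReal.ofReal_sub _ (by linarith)]
  exact ENNReal.ofReal_le_ofReal (by linarith)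

theorem lazyMDP_tableLaw_not_agree_le (n : ℕ) :
    (lazyMDP p hp hp3 x).tableLaw.real (agreeBelow (lazySample x) n)ᶜ ≤ 12 * n * p := by
  have h := (lazyMDP p hp hp3 x).tableLaw_not_agree_le (lazySample x) n
    (lazyMDP_sampleLaw_compl p hp hp3 x)
  have h2 := ENNReal.toReal_mono (by finiteness) h
  rw [ENNReal.toReal_mul, ENNReal.toReal_mul, ENNReal.toReal_ofReal (by linarith)] at h2
  simp only [ENNReal.toReal_natCast, Fintype.card_prod, Fintype.card_fin] at h2
  refine h2.trans (le_of_eq ?_)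
  push_cast
  ring

end

/-! ### The lower bound -/

/-- For fixed `T`, the jump probability `p` is chosen so small that `n ≥ 2 T` rows of samples show
a jump with probability at most `1 / 8`. -/
theorem exists_lazyMDP_lt_expectedSamples (δ Δ : ℝ) (hδ : δ < 1 / (2 * Real.exp 4)) (T : ℝ)
    (hT : 0 < T) :
    ∃ M : MDP (Fin 3) (Fin 2), M.IsErgodic ∧ M.HasOptimalBiasSpan (1 / 2) ∧
      ∀ alg : GenAlgorithm (Fin 3) (Fin 2), alg.ComputesTightUpperBound Δ δ →
        ENNReal.ofReal T < alg.expectedSamples M := by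
  obtain ⟨n, hn⟩ := exists_nat_ge (2 * T)
  have hn0 : (0 : ℝ) < n := by linarith
  have hn1 : (1 : ℝ) ≤ n := by exact_mod_cast Nat.cast_pos.mp hn0
  set p : ℝ := 1 / (96 * n) with hpdef
  have hp : 0 < p := by positivity
  have hpn : 12 * n * p = 1 / 8 := by rw [hpdef]; field_simp; norm_num
  have hp3 : p ≤ 1 / 3 := by nlinarith
  -- The ratio `L` of the jump probabilities makes the second span equal to `L / 2 = 1 + |Δ|`.
  set L : ℝ := 2 * (1 + |Δ|) with hL
  have hL1 : 1 ≤ L := by have := abs_nonneg Δ; linarith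
  have hp' : 0 < p / L := by positivity
  have hpL3 : p / L ≤ 1 / 3 := (div_le_self hp.le hL1).trans hp3
  let x : unitInterval := ⟨3 * p / 2, by constructor <;> linarith⟩
  have hspan : (lazyMDP p hp hp3 x).HasOptimalBiasSpan (1 / 2) := by
    have h : (x : ℝ) / (3 * p) = 1 / 2 := by simp only [x]; field_simp
    rw [← h]
    exact lazyMDP_hasOptimalBiasSpan p hp hp3 x
  have hspan' : (lazyMDP (p / L) hp' hpL3 x).HasOptimalBiasSpan (1 + |Δ|) := by
    have h : (x : ℝ) / (3 * (p / L)) = 1 + |Δ| := by simp only [x, hL]; field_simp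
    rw [← h]
    exact lazyMDP_hasOptimalBiasSpan (p / L) hp' hpL3 x
  refine ⟨lazyMDP p hp hp3 x, lazyMDP_isErgodic p hp hp3 x, hspan, fun alg halg => ?_⟩
  by_contra hle
  have hη := lazyMDP_tableLaw_not_agree_le p hp hp3 x n
  have hη' := lazyMDP_tableLaw_not_agree_le (p / L) hp' hpL3 x n
  have hmono : 12 * n * (p / L) ≤ 12 * n * p :=
    mul_le_mul_of_nonneg_left (div_le_self hp.le hL1) (by positivity)
  have h := alg.one_le_of_expectedSamples_le halg
    (lazyMDP_isErgodic p hp hp3 x).isWeaklyCommunicating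
    (lazyMDP_isErgodic (p / L) hp' hpL3 x).isWeaklyCommunicating hspan hspan'
    (by ext s a; simp only [lazyMDP_meanReward])
    (by have := le_abs_self Δ; linarith) (lazySample x) (Nat.cast_pos.mp hn0)
    (hη.trans hpn.le) (hη'.trans (hmono.trans hpn.le)) hT.le (not_lt.mp hle)
  have hTn : T / n ≤ 1 / 2 := by
    rw [div_le_iff₀ hn0]; linarith
  have hexp : (5 : ℝ) ≤ Real.exp 4 := by
    have := Real.add_one_le_exp (4 : ℝ)
    linarith
  have hδ' : δ < 1 / 10 := by
    refine hδ.trans_le ?_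
    gcongr
    linarith
  linarith

theorem mainTheorem1 (δ Δ : ℝ) (hδ : δ < 1 / (2 * Real.exp 4)) :
    (∀ T : ℝ, 0 < T →
      ∃ M : MDP (Fin 3) (Fin 2), M.IsErgodic ∧ M.HasOptimalBiasSpan (1 / 2) ∧
        ∀ alg : GenAlgorithm (Fin 3) (Fin 2), alg.ComputesTightUpperBound Δ δ →
          ENNReal.ofReal T < alg.expectedSamples M) ∧
    (∀ f : ℕ → ℕ → ℝ → ℝ → ℝ → ℝ,
      ¬ ∃ alg : GenAlgorithm (Fin 3) (Fin 2), alg.ComputesTightUpperBound Δ δ ∧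
        ∀ (M : MDP (Fin 3) (Fin 2)) (H : ℝ), M.IsErgodic → M.HasOptimalBiasSpan H →
          alg.expectedSamples M ≤ ENNReal.ofReal (f 3 2 H δ Δ)) := by
  refine ⟨exists_lazyMDP_lt_expectedSamples δ Δ hδ, ?_⟩
  rintro f ⟨alg, halg, hf⟩
  obtain ⟨M, hM, hH, hlt⟩ := exists_lazyMDP_lt_expectedSamples δ Δ hδ
    (max (f 3 2 (1 / 2) δ Δ) 1) (lt_max_of_lt_right one_pos)
  have h1 := (hlt alg halg).trans_le (hf M _ hM hH)
  exact absurd h1 (not_lt.mpr (ENNReal.ofReal_le_ofReal (le_max_left _ _)))
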